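/- Let $n\ge 0$ and $m\ge 1$ be integers, let $A\in\mathbb R^{n\times n}$, $B\in\mathbb R^{n\times m}$ with $(A,B)$ controllable, let $Q\in\mathbb R^{n\times n}$ and $R\in\mathbb R^{m\times m}$ be symmetric positive definite, and put $\bar Q=\operatorname{diag}(Q,R)$ and $\eta=\tfrac12(n+m)(n+m+1)$. For $K\in\mathbb R^{m\times n}$ let $$\Phi_K=\begin{bmatrix}A&B\\-KA&-KB\end{bmatrix},$$ call $K$ stabilizing if all eigenvalues of $A-BK$ lie strictly inside the unit circle, and partition a matrix $\Theta$ of size $n+m$ as $\Theta=\begin{bmatrix}\Theta_{xx}&\Theta_{xu}\\ \Theta_{ux}&\Theta_{uu}\end{bmatrix}$ with $\Theta_{xx}\in\mathbb R^{n\times n}$, $\Theta_{uu}\in\mathbb R^{m\times m}$. Norms of matrices are spectral norms. *Data.* Let $x_0,\dots,x_\eta$ and $u_0,\dots,u_\eta$ satisfy $x_{k+1}=Ax_k+Bu_k$ for $0\le k<\eta$. Assume that $u_0,\dots,u_\eta$ is persistently exciting of order $n+1$, i.e. the block Hankel matrix with block rows $(u_j,u_{j+1},\dots,u_{j+\eta-n})$,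 $j=0,\dots,n$, has full row rank $m(n+1)$, and that, with $z_k=[x_k^\top\ u_k^\top]^\top$, the $\eta$ symmetric matrices $z_kz_k^\top$, $k=0,\dots,\eta-1$, are linearly independent. *Algorithm 1.* Let $K^0$ be stabilizing. For $i=0,1,2,\dots$ let $\Theta^{i+1}$ be a symmetric solution of the $\eta$ linear equations $$z_k^\top\Theta^{i+1}z_k=z_k^\top\bar Qz_k+\zeta_{i,k+1}^\top\Theta^{i+1}\zeta_{i,k+1},\qquad \zeta_{i,k+1}=\begin{bmatrix}x_{k+1}\\-K^ix_{k+1}\end{bmatrix},\qquad k=0,\dots,\eta-1,$$ and put $K^{i+1}=(\Theta^{i+1}_{uu})^{-1}\Theta^{i+1}_{ux}$. Then such a sequence of iterates exists, and the Riccati equation $P=Q+A^\top PA-A^\top PB(R+B^\top PB)^{-1}B^\top PA$ has a positive definite solution. Moreover, let $(\Theta^i)_{i\ge1}$, $(K^i)_{i\ge0}$ be any such sequence of iterates, let $P$ be any positive definite solution of the Riccati equation, let $K^*=(R+B^\top PB)^{-1}B^\top PA$ be the optimal LQR gain, and let $\Theta^*$ be such that $\Theta^*=\bar Q+\Phi_{K^*}^\top\Theta^*\Phi_{K^*}$.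 Then $\Theta^i\to\Theta^*$, and the convergence is quadratic: for every $i\ge1$ the series $\sum_{j\ge0}(\Phi_{K^i}^j)^\top\Phi_{K^i}^j$ converges and $$\|\Theta^{i+1}-\Theta^*\|\le\gamma^{(i)}\,\|\Theta^i-\Theta^*\|^2,\qquad \gamma^{(i)}=\gamma_1^{(i)}\,\|\bar\Theta_u^*\|>0,$$ where $$\gamma_1^{(i)}=\operatorname{tr}\Big(\sum_{j=0}^\infty(\Phi_{K^i}^j)^\top\Phi_{K^i}^j\Big),\qquad \bar\Theta_u^*=\begin{bmatrix}0&0\\0&(\Theta^*_{uu})^{-1}\end{bmatrix};$$ and there is a single $\gamma>0$ such that $\|\Theta^{i+1}-\Theta^*\|\le\gamma\|\Theta^i-\Theta^*\|^2$ for all $i\ge1$. -/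

import Mathlib

open Filter Topology
open scoped Matrix Matrix.Norms.L2Operator

namespace QLearning

/-- Controllability of the pair `(A, B)`: the matrix `[B, AB, …, A^(n-1) B]` has rank `n`. -/
def Controllable {n m : ℕ} (A : Matrix (Fin n) (Fin n) ℝ) (B : Matrix (Fin n) (Fin m) ℝ) : Prop :=
  (Matrix.of fun (i : Fin n) (c : Fin n × Fin m) => (A ^ (c.1 : ℕ) * B) i c.2).rank = n

/-- The block Hankel matrix `H_L(u)` of the finite signal `u 0, …, u (N - 1)`, for `L ≤ N`. -/
def hankel {m : ℕ} (u : ℕ → Fin m → ℝ) (N L : ℕ) :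
    Matrix (Fin L × Fin m) (Fin (N + 1 - L)) ℝ :=
  Matrix.of fun r c => u ((r.1 : ℕ) + (c : ℕ)) r.2

/-- The signal `u 0, …, u (N - 1)` is persistently exciting of order `L`:
the Hankel matrix `H_L(u)` has full row rank `m L`. -/
def PersistentlyExciting {m : ℕ} (u : ℕ → Fin m → ℝ) (N L : ℕ) : Prop :=
  L ≤ N ∧ (hankel u N L).rank = m * L

/-- All (complex) eigenvalues of the real matrix `M` lie strictly inside the unit circle. -/
def IsSchur {n : ℕ} (M : Matrix (Fin n) (Fin n) ℝ) : Prop :=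
  ∀ μ ∈ spectrum ℂ (M.map Complex.ofReal), ‖μ‖ < 1

/-- The feedback `u = -K x` stabilizes `x_{k+1} = A x_k + B u_k`. -/
def IsStabilizing {n m : ℕ} (A : Matrix (Fin n) (Fin n) ℝ) (B : Matrix (Fin n) (Fin m) ℝ)
    (K : Matrix (Fin m) (Fin n) ℝ) : Prop :=
  IsSchur (A - B * K)

/-- The number `η = (n + m)(n + m + 1) / 2` of unknowns of a symmetric matrix of size `n + m`. -/
def numUnknowns (n m : ℕ) : ℕ := (n + m) * (n + m + 1) / 2

/-- The stacked vector `[x; u]`. -/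
def stack {n m : ℕ} (x : Fin n → ℝ) (u : Fin m → ℝ) : Fin n ⊕ Fin m → ℝ := Sum.elim x u

/-- `Q̄ = diag(Q, R)`. -/
def Qbar {n m : ℕ} (Q : Matrix (Fin n) (Fin n) ℝ) (R : Matrix (Fin m) (Fin m) ℝ) :
    Matrix (Fin n ⊕ Fin m) (Fin n ⊕ Fin m) ℝ :=
  Matrix.fromBlocks Q 0 0 R

/-- The matrix `Φ = [A, B; -K A, -K B]`. -/
def Phi {n m : ℕ} (A : Matrix (Fin n) (Fin n) ℝ) (B : Matrix (Fin n) (Fin m) ℝ)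
    (K : Matrix (Fin m) (Fin n) ℝ) : Matrix (Fin n ⊕ Fin m) (Fin n ⊕ Fin m) ℝ :=
  Matrix.fromBlocks A B (-(K * A)) (-(K * B))

/-- The improved gain `Θ_uu⁻¹ Θ_ux`, where `Θ = [Θ_xx, Θ_uxᵀ; Θ_ux, Θ_uu]`. -/
noncomputable def improvedGain {n m : ℕ} (Θ : Matrix (Fin n ⊕ Fin m) (Fin n ⊕ Fin m) ℝ) :
    Matrix (Fin m) (Fin n) ℝ :=
  Θ.toBlocks₂₂⁻¹ * Θ.toBlocks₂₁

/-- `Θ` is a symmetric solution of the `η` data equations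
`z_kᵀ Θ z_k = z_kᵀ Q̄ z_k + ζ_{k+1}ᵀ Θ ζ_{k+1}`, `k = 0, …, η - 1`, where `z_k = [x_k; u_k]` and
`ζ_{k+1} = [x_{k+1}; -K x_{k+1}]`. -/
def SolvesDataEquations {n m : ℕ} (Q : Matrix (Fin n) (Fin n) ℝ) (R : Matrix (Fin m) (Fin m) ℝ)
    (x : ℕ → Fin n → ℝ) (u : ℕ → Fin m → ℝ) (K : Matrix (Fin m) (Fin n) ℝ)
    (Θ : Matrix (Fin n ⊕ Fin m) (Fin n ⊕ Fin m) ℝ) : Prop :=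
  Θ.IsSymm ∧ ∀ k < numUnknowns n m,
    stack (x k) (u k) ⬝ᵥ (Θ *ᵥ stack (x k) (u k)) =
      stack (x k) (u k) ⬝ᵥ (Qbar Q R *ᵥ stack (x k) (u k)) +
      stack (x (k + 1)) (-(K *ᵥ x (k + 1))) ⬝ᵥ (Θ *ᵥ stack (x (k + 1)) (-(K *ᵥ x (k + 1))))

/-- `(Θ, K)` is a sequence of iterates of off-policy Q-learning with data `x, u`, started at the
gain `K₀`: `Θ (i + 1)` solves the data equations with the gain `K i`, and `K (i + 1)` is the gain
computed from `Θ (i + 1)`. There is no iterate of index `0` in the sequence `Θ`, and the value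
`Θ 0` is not used. -/
def IsRun {n m : ℕ} (Q : Matrix (Fin n) (Fin n) ℝ) (R : Matrix (Fin m) (Fin m) ℝ)
    (x : ℕ → Fin n → ℝ) (u : ℕ → Fin m → ℝ) (K₀ : Matrix (Fin m) (Fin n) ℝ)
    (Θ : ℕ → Matrix (Fin n ⊕ Fin m) (Fin n ⊕ Fin m) ℝ)
    (K : ℕ → Matrix (Fin m) (Fin n) ℝ) : Prop :=
  K 0 = K₀ ∧ ∀ i, SolvesDataEquations Q R x u (K i) (Θ (i + 1)) ∧
    K (i + 1) = improvedGain (Θ (i + 1))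

/-- `P` is a positive definite solution of the discrete-time algebraic Riccati equation
`P = Q + Aᵀ P A - Aᵀ P B (R + Bᵀ P B)⁻¹ Bᵀ P A`. -/
def IsRiccatiSolution {n m : ℕ} (A : Matrix (Fin n) (Fin n) ℝ) (B : Matrix (Fin n) (Fin m) ℝ)
    (Q : Matrix (Fin n) (Fin n) ℝ) (R : Matrix (Fin m) (Fin m) ℝ)
    (P : Matrix (Fin n) (Fin n) ℝ) : Prop :=
  P.PosDef ∧ P = Q + Aᵀ * P * A - Aᵀ * P * B * (R + Bᵀ * P * B)⁻¹ * (Bᵀ * P * A)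

/-- The optimal LQR gain `K* = (R + Bᵀ P B)⁻¹ Bᵀ P A`. -/
noncomputable def lqrGain {n m : ℕ} (A : Matrix (Fin n) (Fin n) ℝ) (B : Matrix (Fin n) (Fin m) ℝ)
    (R : Matrix (Fin m) (Fin m) ℝ) (P : Matrix (Fin n) (Fin n) ℝ) : Matrix (Fin m) (Fin n) ℝ :=
  (R + Bᵀ * P * B)⁻¹ * (Bᵀ * P * A)

/-- `γ₁ = tr (∑_j (Φ^j)ᵀ Φ^j)`, for a matrix `Φ` for which the series converges. -/
noncomputable def gamma1 {n m : ℕ} (Φ : Matrix (Fin n ⊕ Fin m) (Fin n ⊕ Fin m) ℝ) : ℝ :=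
  (∑' j : ℕ, (Φ ^ j)ᵀ * Φ ^ j).trace

/-- `Θ̄_u = [0, 0; 0, Θ_uu⁻¹]`. -/
noncomputable def ThetaBarU {n m : ℕ} (Θ : Matrix (Fin n ⊕ Fin m) (Fin n ⊕ Fin m) ℝ) :
    Matrix (Fin n ⊕ Fin m) (Fin n ⊕ Fin m) ℝ :=
  Matrix.fromBlocks 0 0 0 Θ.toBlocks₂₂⁻¹

end QLearning

open QLearning

/-! The `η` independent matrices `z_k z_kᵀ` span the symmetric matrices, and `Φ_K z_k = ζ_{k+1}`.
Hence the data equations are equivalent to the Lyapunov equation `Θ = Q̄ + Φ_Kᵀ Θ Φ_K`, and the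
algorithm is exact policy iteration.

Everything then rests on completing the square (`Phi_conj_eq`): replacing `K` by the improved gain
of `Θ` lowers `Φ_Kᵀ Θ Φ_K` by a positive semidefinite excess. So `Θ` is a Lyapunov function for the
new gain, which keeps stability, and the costs decrease. Their limit solves the Bellman equation
(`IsOptimal`), which is the Riccati equation in other variables and has only one solution.

For the rate, the error of the cost of `K` solves a Lyapunov equation whose source is the excess of
`K` at the optimum (`IsOptimal.sub_eq`). If `K` is the improved gain of `S`, this source is
quadratic in the error of `S` (`gainExcess_improvedGain`); summing the series produces `γ₁`. A
Lyapunov bound depending only on `Q̄` and the decreasing traces makes the constant uniform. -/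

namespace QLearning

/-! ### Lyapunov equations and square-summable powers -/

section Lyapunov

variable {p : Type*} [Fintype p] [DecidableEq p]

/-- The Frobenius norm dominates the spectral norm, by Cauchy–Schwarz on each row. -/
theorem sq_norm_le_trace (M : Matrix p p ℝ) : ‖M‖ ^ 2 ≤ (Mᵀ * M).trace := by
  have htr : (Mᵀ * M).trace = ∑ i, ∑ j, M i j ^ 2 := by
    simp only [Matrix.trace, Matrix.diag, Matrix.mul_apply, Matrix.transpose_apply]
    rw [Finset.sum_comm]
    simp only [sq]
  have h0 : 0 ≤ (Mᵀ * M).trace := by rw [htr]; positivity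
  rw [← Real.le_sqrt (norm_nonneg _) h0, Matrix.l2_opNorm_def]
  refine ContinuousLinearMap.opNorm_le_bound _ (Real.sqrt_nonneg _) fun v => ?_
  rw [EuclideanSpace.norm_eq, EuclideanSpace.norm_eq, ← Real.sqrt_mul h0, htr]
  refine Real.sqrt_le_sqrt ?_
  rw [Finset.sum_mul]
  refine Finset.sum_le_sum fun i _ => ?_
  simpa [Matrix.mulVec, dotProduct] using
    Finset.sum_mul_sq_le_sq_mul_sq Finset.univ (M i) v

theorem PosSemidef.exists_eq_transpose_mul_self {S : Matrix p p ℝ} (hS : S.PosSemidef) :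
    ∃ B : Matrix p p ℝ, S = Bᵀ * B := by
  open scoped MatrixOrder in
  obtain ⟨B, hB⟩ := CStarAlgebra.nonneg_iff_eq_star_mul_self.mp hS.nonneg
  exact ⟨B, hB⟩

theorem sq_norm_eq (M : Matrix p p ℝ) : ‖Mᵀ * M‖ = ‖M‖ ^ 2 := by
  rw [sq, ← Matrix.l2_opNorm_conjTranspose_mul_self, Matrix.conjTranspose_eq_transpose_of_trivial]

theorem norm_transpose (M : Matrix p p ℝ) : ‖Mᵀ‖ = ‖M‖ := by
  rw [← Matrix.conjTranspose_eq_transpose_of_trivial, Matrix.l2_opNorm_conjTranspose]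

theorem PosSemidef.norm_le_trace {S : Matrix p p ℝ} (hS : S.PosSemidef) : ‖S‖ ≤ S.trace := by
  obtain ⟨B, rfl⟩ := PosSemidef.exists_eq_transpose_mul_self hS
  rw [sq_norm_eq]
  exact sq_norm_le_trace B

omit [DecidableEq p] in
theorem PosSemidef.conj {q : Type*} [Fintype q] {S : Matrix p p ℝ} (hS : S.PosSemidef)
    (M : Matrix p q ℝ) : (Mᵀ * S * M).PosSemidef := by
  simpa [Matrix.conjTranspose_eq_transpose_of_trivial] using hS.conjTranspose_mul_mul_same M

theorem PosDef.exists_sq_norm_le {S : Matrix p p ℝ} (hS : S.PosDef) :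
    ∃ c > 0, ∀ M : Matrix p p ℝ, ‖M‖ ^ 2 ≤ c * (Mᵀ * S * M).trace := by
  obtain ⟨B, hB⟩ := PosSemidef.exists_eq_transpose_mul_self hS.posSemidef
  have hu : IsUnit B := by
    have := hS.isUnit
    rw [hB, Matrix.isUnit_iff_isUnit_det, Matrix.det_mul] at this
    exact (Matrix.isUnit_iff_isUnit_det _).2 (isUnit_of_mul_isUnit_right this)
  have hinv : B⁻¹ * B = 1 := Matrix.nonsing_inv_mul _ ((Matrix.isUnit_iff_isUnit_det _).1 hu)
  -- The summand 1 keeps the constant positive when the index type is empty.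
  refine ⟨‖B⁻¹‖ ^ 2 + 1, by positivity, fun M => ?_⟩
  have h1 : ‖M‖ ≤ ‖B⁻¹‖ * ‖B * M‖ := by
    calc ‖M‖ = ‖B⁻¹ * (B * M)‖ := by rw [← Matrix.mul_assoc, hinv, Matrix.one_mul]
      _ ≤ _ := norm_mul_le _ _
  have h2 : ‖B * M‖ ^ 2 ≤ (Mᵀ * S * M).trace := by
    have := sq_norm_le_trace (B * M)
    rwa [Matrix.transpose_mul, show Mᵀ * Bᵀ * (B * M) = Mᵀ * S * M by
      rw [hB]; simp only [Matrix.mul_assoc]] at this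
  calc ‖M‖ ^ 2 ≤ (‖B⁻¹‖ * ‖B * M‖) ^ 2 := by gcongr
    _ = ‖B⁻¹‖ ^ 2 * ‖B * M‖ ^ 2 := by ring
    _ ≤ (‖B⁻¹‖ ^ 2 + 1) * (Mᵀ * S * M).trace := by
      gcongr
      linarith

theorem norm_conj_le (X M : Matrix p p ℝ) : ‖Mᵀ * X * M‖ ≤ ‖X‖ * ‖M‖ ^ 2 := by
  calc ‖Mᵀ * X * M‖ ≤ ‖Mᵀ‖ * ‖X‖ * ‖M‖ := by
        refine (norm_mul_le _ _).trans ?_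
        gcongr
        exact norm_mul_le _ _
    _ = _ := by rw [norm_transpose]; ring

omit [DecidableEq p] in
theorem posSemidef_closed : IsClosed {S : Matrix p p ℝ | S.PosSemidef} := by
  have : {S : Matrix p p ℝ | S.PosSemidef} =
      {S | Sᵀ = S} ∩ ⋂ v : p → ℝ, {S | 0 ≤ v ⬝ᵥ (S *ᵥ v)} := by
    ext S
    simp [Matrix.posSemidef_iff_dotProduct_mulVec, Matrix.IsHermitian,
      Matrix.conjTranspose_eq_transpose_of_trivial]
  rw [this]
  refine (isClosed_eq (by fun_prop) (by fun_prop)).inter (isClosed_iInter fun v => ?_)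
  exact isClosed_le (by fun_prop) (by fun_prop)

/-- The powers of `Φ` are square summable. -/
def PowSqSummable (Φ : Matrix p p ℝ) : Prop := Summable fun j : ℕ => ‖Φ ^ j‖ ^ 2

namespace PowSqSummable

variable {Φ : Matrix p p ℝ}

theorem summable_conj (h : PowSqSummable Φ) (X : Matrix p p ℝ) :
    Summable fun j : ℕ => (Φ ^ j)ᵀ * X * Φ ^ j :=
  Summable.of_norm_bounded (h.mul_left ‖X‖) fun _ => norm_conj_le _ _

theorem conj_tendsto_zero (h : PowSqSummable Φ) (X : Matrix p p ℝ) :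
    Tendsto (fun j : ℕ => (Φ ^ j)ᵀ * X * Φ ^ j) atTop (𝓝 0) :=
  (h.summable_conj X).tendsto_atTop_zero

end PowSqSummable

/-- With `X = D - Φᵀ D Φ` the sum telescopes. No stability is needed, so the identity also serves to
prove it. -/
theorem sum_range_conj_pow {Φ D X : Matrix p p ℝ} (hD : D = X + Φᵀ * D * Φ) (N : ℕ) :
    ∑ j ∈ Finset.range N, (Φ ^ j)ᵀ * X * Φ ^ j = D - (Φ ^ N)ᵀ * D * Φ ^ N := by
  induction N with
  | zero => simp
  | succ N ih =>
    have hX : X = D - Φᵀ * D * Φ := eq_sub_of_add_eq hD.symm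
    rw [Finset.sum_range_succ, ih, pow_succ', Matrix.transpose_mul, hX]
    noncomm_ring

theorem PowSqSummable.hasSum {Φ D X : Matrix p p ℝ} (h : PowSqSummable Φ)
    (hD : D = X + Φᵀ * D * Φ) : HasSum (fun j : ℕ => (Φ ^ j)ᵀ * X * Φ ^ j) D := by
  refine (h.summable_conj X).hasSum_iff_tendsto_nat.2 ?_
  simp_rw [sum_range_conj_pow hD]
  simpa using tendsto_const_nhds.sub (h.conj_tendsto_zero D)

theorem PowSqSummable.solution {Φ : Matrix p p ℝ} (h : PowSqSummable Φ) (X : Matrix p p ℝ) :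
    (∑' j : ℕ, (Φ ^ j)ᵀ * X * Φ ^ j) =
      X + Φᵀ * (∑' j : ℕ, (Φ ^ j)ᵀ * X * Φ ^ j) * Φ := by
  have hs := h.summable_conj X
  rw [← hs.tsum_mul_left, ← (hs.mul_left _).tsum_mul_right, hs.tsum_eq_zero_add]
  simp [pow_succ, Matrix.transpose_mul, Matrix.mul_assoc]

omit [DecidableEq p] in
theorem posSemidef_of_hasSum {f : ℕ → Matrix p p ℝ} {D : Matrix p p ℝ} (hf : HasSum f D)
    (h : ∀ j, (f j).PosSemidef) : D.PosSemidef :=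
  posSemidef_closed.mem_of_tendsto hf.tendsto_sum_nat
    (Eventually.of_forall fun _ => Matrix.posSemidef_sum _ fun j _ => h j)

theorem PowSqSummable.posSemidef {Φ D X : Matrix p p ℝ} (h : PowSqSummable Φ)
    (hD : D = X + Φᵀ * D * Φ) (hX : X.PosSemidef) : D.PosSemidef :=
  posSemidef_of_hasSum (h.hasSum hD) fun _ => PosSemidef.conj hX _

theorem PowSqSummable.unique {Φ D E X : Matrix p p ℝ} (h : PowSqSummable Φ)
    (hD : D = X + Φᵀ * D * Φ) (hE : E = X + Φᵀ * E * Φ) : D = E :=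
  (h.hasSum hD).unique (h.hasSum hE)

/-- Lyapunov's criterion, with a bound on the square sum that is uniform in `Φ`. -/
theorem exists_tsum_sq_norm_le {S : Matrix p p ℝ} (hS : S.PosDef) :
    ∃ c > 0, ∀ Φ D Y : Matrix p p ℝ, D.PosSemidef → Y.PosSemidef → D = S + Y + Φᵀ * D * Φ →
      PowSqSummable Φ ∧ ∑' j : ℕ, ‖Φ ^ j‖ ^ 2 ≤ c * D.trace := by
  obtain ⟨c, hc, hb⟩ := PosDef.exists_sq_norm_le hS
  refine ⟨c, hc, fun Φ D Y hD hY h => ?_⟩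
  -- Take traces in the telescoped identity; the remainder and the contribution of `Y` are
  -- nonnegative and can be dropped.
  have key : ∀ N, ∑ j ∈ Finset.range N, ‖Φ ^ j‖ ^ 2 ≤ c * D.trace := fun N => by
    have h1 := congrArg Matrix.trace (sum_range_conj_pow h N)
    rw [Matrix.trace_sub, Matrix.trace_sum] at h1
    have h2 := (PosSemidef.conj hD (Φ ^ N)).trace_nonneg
    calc ∑ j ∈ Finset.range N, ‖Φ ^ j‖ ^ 2
        ≤ ∑ j ∈ Finset.range N, c * ((Φ ^ j)ᵀ * (S + Y) * Φ ^ j).trace := by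
          refine Finset.sum_le_sum fun j _ => (hb _).trans ?_
          gcongr
          rw [Matrix.mul_add, Matrix.add_mul, Matrix.trace_add]
          linarith [(PosSemidef.conj hY (Φ ^ j)).trace_nonneg]
      _ ≤ c * D.trace := by
          rw [← Finset.mul_sum, h1]
          gcongr
          linarith
  exact ⟨summable_of_sum_range_le (fun _ => by positivity) key,
    Real.tsum_le_of_sum_range_le (fun _ => by positivity) key⟩

theorem PowSqSummable.of_lyapunov {S Φ D Y : Matrix p p ℝ} (hS : S.PosDef) (hD : D.PosSemidef)
    (hY : Y.PosSemidef) (h : D = S + Y + Φᵀ * D * Φ) : PowSqSummable Φ := by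
  obtain ⟨c, -, hc⟩ := exists_tsum_sq_norm_le hS
  exact (hc Φ D Y hD hY h).1

/-- An antitone sequence of positive semidefinite matrices converges. -/
theorem exists_tendsto_of_antitone {S : ℕ → Matrix p p ℝ} (h0 : ∀ i, (S i).PosSemidef)
    (h : ∀ i, (S i - S (i + 1)).PosSemidef) : ∃ T, Tendsto S atTop (𝓝 T) := by
  have hle : ∀ i j, i ≤ j → (S i - S j).PosSemidef := fun i j hij => by
    induction j, hij using Nat.le_induction with
    | base => simpa using Matrix.PosSemidef.zero
    | succ j _ ih => simpa using ih.add (h j)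
  have htr : Antitone fun i => (S i).trace := fun i j hij => by
    have := (hle i j hij).trace_nonneg
    rw [Matrix.trace_sub] at this
    linarith
  have hbd : BddBelow (Set.range fun i => (S i).trace) :=
    ⟨0, by rintro _ ⟨i, rfl⟩; exact (h0 i).trace_nonneg⟩
  have hlim := tendsto_atTop_ciInf htr hbd
  -- The norm of a positive semidefinite difference is at most its trace, so convergence of the
  -- traces forces the Cauchy property.
  refine cauchySeq_tendsto_of_complete (cauchySeq_of_le_tendsto_0'
    (fun i => (S i).trace - ⨅ i, (S i).trace) (fun i j hij => ?_) ?_)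
  · rw [dist_eq_norm]
    refine (PosSemidef.norm_le_trace (hle i j hij)).trans ?_
    rw [Matrix.trace_sub]
    linarith [ciInf_le hbd j]
  · simpa using hlim.sub_const (⨅ i, (S i).trace)

end Lyapunov

/-! ### From eigenvalues to square-summable powers -/

/-- By Gelfand's formula, `‖a ^ j‖ ≤ r ^ j` eventually, for some `r < 1`. -/
theorem summable_sq_norm_pow_of_spectralRadius_lt_one {𝔸 : Type*} [NormedRing 𝔸]
    [NormedAlgebra ℂ 𝔸] [CompleteSpace 𝔸] (a : 𝔸) (ha : spectralRadius ℂ a < 1) :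
    Summable fun j : ℕ => ‖a ^ j‖ ^ 2 := by
  obtain ⟨r, hr, hr1⟩ := ENNReal.lt_iff_exists_nnreal_btwn.1 ha
  have hr1' : (r : ℝ) < 1 := by exact_mod_cast hr1
  have hev := (spectrum.pow_nnnorm_pow_one_div_tendsto_nhds_spectralRadius a).eventually_lt_const hr
  refine Summable.of_norm_bounded_eventually_nat (g := fun j : ℕ => ((r : ℝ) ^ 2) ^ j)
    (summable_geometric_of_lt_one (by positivity) (by nlinarith [r.coe_nonneg])) ?_
  filter_upwards [hev, eventually_gt_atTop 0] with j hj hj0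
  have h1 : (‖a ^ j‖₊ : ENNReal) ≤ (r : ENNReal) ^ j := by
    have h2 := ENNReal.rpow_le_rpow hj.le (Nat.cast_nonneg (α := ℝ) j)
    rwa [← ENNReal.rpow_mul, one_div_mul_cancel (by positivity), ENNReal.rpow_one,
      ENNReal.rpow_natCast] at h2
  have h3 : ‖a ^ j‖ ≤ (r : ℝ) ^ j := by exact_mod_cast h1
  rw [Real.norm_of_nonneg (by positivity), ← pow_mul, mul_comm, pow_mul]
  gcongr

theorem IsSchur.powSqSummable {n : ℕ} {M : Matrix (Fin n) (Fin n) ℝ} (h : IsSchur M) :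
    PowSqSummable M := by
  rcases Nat.eq_zero_or_pos n with rfl | hn
  · have : ∀ j : ℕ, ‖M ^ j‖ ^ 2 = 0 := fun j => by
      rw [Subsingleton.elim (M ^ j) 0]; simp
    simpa only [PowSqSummable, this] using summable_zero
  have : Nonempty (Fin n) := ⟨⟨0, hn⟩⟩
  have hC := summable_sq_norm_pow_of_spectralRadius_lt_one (M.map Complex.ofReal)
    (by simpa using spectrum.spectralRadius_lt_of_forall_lt (r := 1) (M.map Complex.ofReal)
          fun z hz => h z hz)
  -- The entrywise real part is bounded and recovers `M ^ j` from the complex power, so the norms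
  -- compare up to a constant.
  let re : Matrix (Fin n) (Fin n) ℂ →ₗ[ℝ] Matrix (Fin n) (Fin n) ℝ := Complex.reLm.mapMatrix
  let re' := LinearMap.toContinuousLinearMap re
  have hre : ∀ j, re' ((M.map Complex.ofReal) ^ j) = M ^ j := fun j => by
    have := map_pow (Complex.ofRealHom.mapMatrix (m := Fin n)) M j
    simp only [RingHom.mapMatrix_apply] at this
    ext a b
    have h2 := congrFun (congrFun this a) b
    have h3 := congrArg Complex.re h2
    exact h3.symm
  refine Summable.of_nonneg_of_le (fun _ => by positivity) (fun j => ?_)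
    (hC.mul_left (‖re'‖ ^ 2))
  rw [← hre, ← mul_pow]
  gcongr
  exact re'.le_opNorm _

/-! ### The data equations as a Lyapunov equation -/

/-- A symmetric matrix is determined by its quadratic form at as many points as it has unknowns,
if the squares of these points are linearly independent. -/
theorem eq_zero_of_forall_dotProduct_mulVec {p : Type*} [Fintype p] [DecidableEq p] {N : ℕ}
    (hN : N = (Fintype.card p + 1).choose 2) (z : Fin N → p → ℝ)
    (hz : LinearIndependent ℝ fun k => Matrix.vecMulVec (z k) (z k))
    {D : Matrix p p ℝ} (hD : D.IsSymm) (h : ∀ k, z k ⬝ᵥ (D *ᵥ z k) = 0) : D = 0 := by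
  let sym : (Sym2 p → ℝ) →ₗ[ℝ] Matrix p p ℝ :=
    { toFun := fun f => Matrix.of fun a b => f s(a, b)
      map_add' := fun _ _ => rfl
      map_smul' := fun _ _ => rfl }
  -- Functions on unordered pairs form a space of dimension exactly `N`, so the independent squares
  -- span it.
  let w : Fin N → Sym2 p → ℝ := fun k =>
    Sym2.lift ⟨fun a b => z k a * z k b, fun a b => mul_comm _ _⟩
  have hw : LinearIndependent ℝ w := LinearIndependent.of_comp sym hz
  have hspan : Submodule.span ℝ (Set.range w) = ⊤ :=
    hw.span_eq_top_of_card_eq_finrank' (by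
      rw [Module.finrank_fintype_fun_eq_card, Sym2.card, Fintype.card_fin, hN])
  let φ : (Sym2 p → ℝ) →ₗ[ℝ] ℝ := ∑ a, ∑ b, D a b • LinearMap.proj s(a, b)
  have hφ : φ = 0 := LinearMap.ext_on_range hspan fun k => by
    rw [LinearMap.zero_apply, ← h k]
    simp [φ, w, dotProduct, Matrix.mulVec, Finset.mul_sum]
    exact Finset.sum_congr rfl fun a _ => Finset.sum_congr rfl fun b _ => by ring
  -- Evaluating the vanishing functional at `D` itself gives the sum of the squared entries.
  have h0 := LinearMap.congr_fun hφ (Sym2.lift ⟨D, fun a b => hD.apply b a⟩)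
  simp only [φ, LinearMap.sum_apply, LinearMap.smul_apply, LinearMap.proj_apply, Sym2.lift_mk,
    LinearMap.zero_apply, smul_eq_mul] at h0
  ext a b
  have h1 := (Finset.sum_eq_zero_iff_of_nonneg
    (fun a _ => Finset.sum_nonneg fun b _ => mul_self_nonneg (D a b))).1 h0 a (Finset.mem_univ a)
  have h2 := (Finset.sum_eq_zero_iff_of_nonneg (fun b _ => mul_self_nonneg (D a b))).1 h1 b
    (Finset.mem_univ b)
  simpa using h2

variable {n m : ℕ} {A : Matrix (Fin n) (Fin n) ℝ} {B : Matrix (Fin n) (Fin m) ℝ}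
  {Q : Matrix (Fin n) (Fin n) ℝ} {R : Matrix (Fin m) (Fin m) ℝ}

theorem Phi_mulVec_stack (K : Matrix (Fin m) (Fin n) ℝ) (x : Fin n → ℝ) (u : Fin m → ℝ) :
    Phi A B K *ᵥ stack x u = stack (A *ᵥ x + B *ᵥ u) (-(K *ᵥ (A *ᵥ x + B *ᵥ u))) := by
  simp [Phi, stack, Matrix.fromBlocks_mulVec, Matrix.mulVec_add, Matrix.neg_mulVec]
  abel_nf

theorem dotProduct_conj_mulVec {p : Type*} [Fintype p] (M X : Matrix p p ℝ) (v : p → ℝ) :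
    v ⬝ᵥ ((Mᵀ * X * M) *ᵥ v) = (M *ᵥ v) ⬝ᵥ (X *ᵥ (M *ᵥ v)) := by
  rw [← Matrix.mulVec_mulVec, ← Matrix.mulVec_mulVec, Matrix.mulVec_transpose,
    dotProduct_comm, ← Matrix.dotProduct_mulVec, dotProduct_comm]

/-- Each data equation says that the quadratic form of the Lyapunov residual vanishes at `z_k`. -/
theorem solvesDataEquations_iff {x : ℕ → Fin n → ℝ} {u : ℕ → Fin m → ℝ}
    (hx : ∀ k < numUnknowns n m, x (k + 1) = A *ᵥ x k + B *ᵥ u k)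
    (hz : LinearIndependent ℝ (fun k : Fin (numUnknowns n m) =>
      Matrix.vecMulVec (stack (x k) (u k)) (stack (x k) (u k))))
    (hQ : Q.IsSymm) (hR : R.IsSymm) {K : Matrix (Fin m) (Fin n) ℝ}
    {Θ : Matrix (Fin n ⊕ Fin m) (Fin n ⊕ Fin m) ℝ} :
    SolvesDataEquations Q R x u K Θ ↔
      Θ.IsSymm ∧ Θ = Qbar Q R + (Phi A B K)ᵀ * Θ * Phi A B K := by
  have key : ∀ k < numUnknowns n m, stack (x k) (u k) ⬝ᵥ
      ((Θ - (Qbar Q R + (Phi A B K)ᵀ * Θ * Phi A B K)) *ᵥ stack (x k) (u k)) =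
      stack (x k) (u k) ⬝ᵥ (Θ *ᵥ stack (x k) (u k)) -
      (stack (x k) (u k) ⬝ᵥ (Qbar Q R *ᵥ stack (x k) (u k)) +
      stack (x (k + 1)) (-(K *ᵥ x (k + 1))) ⬝ᵥ
        (Θ *ᵥ stack (x (k + 1)) (-(K *ᵥ x (k + 1))))) := fun k hk => by
    rw [Matrix.sub_mulVec, Matrix.add_mulVec, dotProduct_sub, dotProduct_add,
      dotProduct_conj_mulVec, Phi_mulVec_stack, hx k hk]
  constructor
  · rintro ⟨hs, h⟩
    refine ⟨hs, sub_eq_zero.1 (eq_zero_of_forall_dotProduct_mulVec ?_ _ hz ?_ fun k => ?_)⟩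
    · simp [numUnknowns, Nat.choose_two_right, mul_comm]
    · refine hs.sub (Matrix.IsSymm.add ?_ ?_)
      · exact Matrix.IsSymm.fromBlocks hQ (by simp) hR
      · simp [Matrix.IsSymm, Matrix.transpose_mul, hs.eq, Matrix.mul_assoc]
    · rw [key k k.2, h k k.2, sub_self]
  · rintro ⟨hs, h⟩
    refine ⟨hs, fun k hk => ?_⟩
    have := key k hk
    rw [← h, sub_self, Matrix.zero_mulVec, dotProduct_zero] at this
    exact (sub_eq_zero.1 this.symm)

/-! ### Gain improvement and the quadratic error estimate -/

section Gains

variable {n m : ℕ} {A : Matrix (Fin n) (Fin n) ℝ} {B : Matrix (Fin n) (Fin m) ℝ}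
  {Q : Matrix (Fin n) (Fin n) ℝ} {R : Matrix (Fin m) (Fin m) ℝ}

/-- The graph map `[1; -K]` of the feedback `u = -K x`. -/
def feedbackRows (K : Matrix (Fin m) (Fin n) ℝ) : Matrix (Fin n ⊕ Fin m) (Fin n) ℝ :=
  Matrix.fromRows 1 (-K)

/-- The projection `[0, 1]` onto the input component. -/
def inputProj (n m : ℕ) : Matrix (Fin m) (Fin n ⊕ Fin m) ℝ := Matrix.fromCols 0 1

theorem Phi_eq_mul (K : Matrix (Fin m) (Fin n) ℝ) :
    Phi A B K = feedbackRows K * Matrix.fromCols A B := by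
  rw [feedbackRows, Matrix.fromRows_mul_fromCols]
  simp [Phi]

theorem fromCols_mul_feedbackRows (K : Matrix (Fin m) (Fin n) ℝ) :
    Matrix.fromCols A B * feedbackRows K = A - B * K := by
  rw [feedbackRows, Matrix.fromCols_mul_fromRows]
  simp [sub_eq_add_neg]

/-- `Φ` factors through the state space, and the product of its factors in the other order is `A - B
K`; thus closed-loop stability passes to `Φ`. -/
theorem Phi_pow_succ (K : Matrix (Fin m) (Fin n) ℝ) (j : ℕ) :
    Phi A B K ^ (j + 1) = feedbackRows K * (A - B * K) ^ j * Matrix.fromCols A B := by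
  induction j with
  | zero => simp [Phi_eq_mul]
  | succ j ih =>
    rw [pow_succ, ih, Phi_eq_mul, pow_succ, ← fromCols_mul_feedbackRows]
    simp only [Matrix.mul_assoc]

theorem IsStabilizing.powSqSummable {K : Matrix (Fin m) (Fin n) ℝ} (h : IsStabilizing A B K) :
    PowSqSummable (Phi A B K) := by
  have h1 : PowSqSummable (A - B * K) := IsSchur.powSqSummable h
  refine (summable_nat_add_iff 1).1 (Summable.of_nonneg_of_le (fun _ => by positivity)
    (fun j => ?_) (h1.mul_left ((‖feedbackRows K‖ * ‖Matrix.fromCols A B‖) ^ 2)))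
  rw [Phi_pow_succ, ← mul_pow]
  gcongr
  calc _ ≤ ‖feedbackRows K * (A - B * K) ^ j‖ * ‖Matrix.fromCols A B‖ := Matrix.l2_opNorm_mul _ _
    _ ≤ ‖feedbackRows K‖ * ‖(A - B * K) ^ j‖ * ‖Matrix.fromCols A B‖ := by
      gcongr
      exact Matrix.l2_opNorm_mul _ _
    _ = _ := by ring

theorem feedbackRows_sub (K L : Matrix (Fin m) (Fin n) ℝ) :
    feedbackRows K = feedbackRows L - (inputProj n m)ᵀ * (K - L) := by
  rw [inputProj, Matrix.transpose_fromCols, Matrix.fromRows_mul]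
  ext (i | i) j
  · simp [feedbackRows]
  · simp only [feedbackRows, Matrix.fromRows_apply_inr, Matrix.neg_apply, Matrix.sub_apply,
      Matrix.transpose_one, Matrix.one_mul]
    ring

theorem inputProj_mul_mul_transpose (Θ : Matrix (Fin n ⊕ Fin m) (Fin n ⊕ Fin m) ℝ) :
    inputProj n m * Θ * (inputProj n m)ᵀ = Θ.toBlocks₂₂ := by
  conv_lhs => rw [← Matrix.fromBlocks_toBlocks Θ]
  rw [inputProj, Matrix.fromCols_mul_fromBlocks, Matrix.transpose_fromCols,
    Matrix.fromCols_mul_fromRows]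
  simp

theorem inputProj_mul_mul_feedbackRows (Θ : Matrix (Fin n ⊕ Fin m) (Fin n ⊕ Fin m) ℝ)
    (K : Matrix (Fin m) (Fin n) ℝ) :
    inputProj n m * Θ * feedbackRows K = Θ.toBlocks₂₁ - Θ.toBlocks₂₂ * K := by
  conv_lhs => rw [← Matrix.fromBlocks_toBlocks Θ]
  rw [inputProj, Matrix.fromCols_mul_fromBlocks, feedbackRows, Matrix.fromCols_mul_fromRows]
  simp [sub_eq_add_neg]

theorem ThetaBarU_eq (Θ : Matrix (Fin n ⊕ Fin m) (Fin n ⊕ Fin m) ℝ) :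
    ThetaBarU Θ = (inputProj n m)ᵀ * Θ.toBlocks₂₂⁻¹ * inputProj n m := by
  rw [inputProj, Matrix.transpose_fromCols, Matrix.fromRows_mul, Matrix.fromRows_mul_fromCols]
  simp [ThetaBarU]

theorem PosDef.toBlocks₂₂ {Θ : Matrix (Fin n ⊕ Fin m) (Fin n ⊕ Fin m) ℝ} (h : Θ.PosDef) :
    Θ.toBlocks₂₂.PosDef :=
  h.submatrix Sum.inr_injective

theorem PosDef.isUnit_det {p : Type*} [Fintype p] [DecidableEq p] {S : Matrix p p ℝ}
    (h : S.PosDef) : IsUnit S.det :=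
  (Matrix.isUnit_iff_isUnit_det _).1 h.isUnit

theorem PosDef.transpose_eq {p : Type*} {S : Matrix p p ℝ} (h : S.PosDef) : Sᵀ = S := by
  simpa [Matrix.IsHermitian, Matrix.conjTranspose_eq_transpose_of_trivial] using h.1

/-- This is stationarity in the input: it removes the cross terms when the square is completed. -/
theorem inputProj_mul_mul_improvedGain {Θ : Matrix (Fin n ⊕ Fin m) (Fin n ⊕ Fin m) ℝ}
    (h : Θ.PosDef) : inputProj n m * Θ * feedbackRows (improvedGain Θ) = 0 := by
  rw [inputProj_mul_mul_feedbackRows, improvedGain, ← Matrix.mul_assoc,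
    Matrix.mul_nonsing_inv _ (PosDef.isUnit_det (PosDef.toBlocks₂₂ h)), Matrix.one_mul, sub_self]

/-- The excess of the cost of the feedback `K` over that of the improved gain of `Θ`. -/
noncomputable def gainExcess (A : Matrix (Fin n) (Fin n) ℝ) (B : Matrix (Fin n) (Fin m) ℝ)
    (Θ : Matrix (Fin n ⊕ Fin m) (Fin n ⊕ Fin m) ℝ) (K : Matrix (Fin m) (Fin n) ℝ) :
    Matrix (Fin n ⊕ Fin m) (Fin n ⊕ Fin m) ℝ :=
  ((K - improvedGain Θ) * Matrix.fromCols A B)ᵀ * Θ.toBlocks₂₂ *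
    ((K - improvedGain Θ) * Matrix.fromCols A B)

theorem posSemidef_gainExcess {Θ : Matrix (Fin n ⊕ Fin m) (Fin n ⊕ Fin m) ℝ} (h : Θ.PosDef)
    (K : Matrix (Fin m) (Fin n) ℝ) : (gainExcess A B Θ K).PosSemidef :=
  PosSemidef.conj (PosDef.toBlocks₂₂ h).posSemidef _

/-- Completion of the square. -/
theorem Phi_conj_eq {Θ : Matrix (Fin n ⊕ Fin m) (Fin n ⊕ Fin m) ℝ} (h : Θ.PosDef)
    (K : Matrix (Fin m) (Fin n) ℝ) :
    (Phi A B K)ᵀ * Θ * Phi A B K = gainExcess A B Θ K +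
      (Phi A B (improvedGain Θ))ᵀ * Θ * Phi A B (improvedGain Θ) := by
  set E := (K - improvedGain Θ) * Matrix.fromCols A B with hE
  set F := Phi A B (improvedGain Θ) with hF
  set J := inputProj n m with hJ
  have h1 : Phi A B K = F - Jᵀ * E := by
    rw [Phi_eq_mul, feedbackRows_sub K (improvedGain Θ), hF, Phi_eq_mul, Matrix.sub_mul,
      Matrix.mul_assoc]
  have h2 : J * Θ * F = 0 := by
    rw [hF, Phi_eq_mul, ← Matrix.mul_assoc, inputProj_mul_mul_improvedGain h, Matrix.zero_mul]
  have h3 : Fᵀ * Θ * Jᵀ = 0 := by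
    have := congrArg Matrix.transpose h2
    simpa [Matrix.transpose_mul, PosDef.transpose_eq h, Matrix.mul_assoc] using this
  rw [gainExcess, ← hE, ← inputProj_mul_mul_transpose, ← hJ, h1, Matrix.transpose_sub,
    Matrix.transpose_mul, Matrix.transpose_transpose]
  calc (Fᵀ - Eᵀ * J) * Θ * (F - Jᵀ * E)
      = Eᵀ * (J * Θ * Jᵀ) * E + Fᵀ * Θ * F - Eᵀ * (J * Θ * F) - (Fᵀ * Θ * Jᵀ) * E := by
        simp only [Matrix.sub_mul, Matrix.mul_sub, Matrix.mul_assoc]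
        abel
    _ = _ := by rw [h2, h3]; simp

theorem posDef_Qbar (hQ : Q.PosDef) (hR : R.PosDef) : (Qbar Q R).PosDef := by
  refine Matrix.PosDef.of_dotProduct_mulVec_pos (Matrix.IsHermitian.fromBlocks hQ.1 (by simp) hR.1)
    fun v hv => ?_
  obtain ⟨x, u, rfl⟩ : ∃ x u, v = Sum.elim x u := ⟨_, _, (Sum.elim_comp_inl_inr v).symm⟩
  have h : star (Sum.elim x u) ⬝ᵥ (Qbar Q R *ᵥ Sum.elim x u) =
      star x ⬝ᵥ (Q *ᵥ x) + star u ⬝ᵥ (R *ᵥ u) := by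
    simp [Qbar, Matrix.fromBlocks_mulVec, dotProduct]
  rw [h]
  by_cases hx : x = 0
  · have hu : u ≠ 0 := by
      rintro rfl
      refine hv ?_
      ext (i | i) <;> simp [hx]
    exact add_pos_of_nonneg_of_pos (hQ.posSemidef.dotProduct_mulVec_nonneg x)
      (hR.dotProduct_mulVec_pos hu)
  · exact add_pos_of_pos_of_nonneg (hQ.dotProduct_mulVec_pos hx)
      (hR.posSemidef.dotProduct_mulVec_nonneg u)

theorem PowSqSummable.posDef {p : Type*} [Fintype p] [DecidableEq p] {Φ D X : Matrix p p ℝ}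
    (h : PowSqSummable Φ) (hD : D = X + Φᵀ * D * Φ) (hX : X.PosDef) : D.PosDef := by
  rw [hD]
  exact hX.add_posSemidef (PosSemidef.conj (h.posSemidef hD hX.posSemidef) Φ)

/-- The cost of `K` solves the Lyapunov equation of the improved gain, up to the excess. -/
theorem eq_add_gainExcess_add {Θ : Matrix (Fin n ⊕ Fin m) (Fin n ⊕ Fin m) ℝ} (h : Θ.PosDef)
    {K : Matrix (Fin m) (Fin n) ℝ} (hΘ : Θ = Qbar Q R + (Phi A B K)ᵀ * Θ * Phi A B K) :
    Θ = Qbar Q R + gainExcess A B Θ K +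
      (Phi A B (improvedGain Θ))ᵀ * Θ * Phi A B (improvedGain Θ) := by
  rw [add_assoc, ← Phi_conj_eq h, ← hΘ]

/-- Policy improvement preserves stability. -/
theorem powSqSummable_improvedGain (hQ : Q.PosDef) (hR : R.PosDef)
    {Θ : Matrix (Fin n ⊕ Fin m) (Fin n ⊕ Fin m) ℝ} (h : Θ.PosDef)
    {K : Matrix (Fin m) (Fin n) ℝ} (hΘ : Θ = Qbar Q R + (Phi A B K)ᵀ * Θ * Phi A B K) :
    PowSqSummable (Phi A B (improvedGain Θ)) :=
  PowSqSummable.of_lyapunov (posDef_Qbar hQ hR) h.posSemidef (posSemidef_gainExcess h K)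
    (eq_add_gainExcess_add h hΘ)

/-- `Θ` is the cost of its own improved gain: the Bellman optimality equation. -/
def IsOptimal (A : Matrix (Fin n) (Fin n) ℝ) (B : Matrix (Fin n) (Fin m) ℝ)
    (Q : Matrix (Fin n) (Fin n) ℝ) (R : Matrix (Fin m) (Fin m) ℝ)
    (Θ : Matrix (Fin n ⊕ Fin m) (Fin n ⊕ Fin m) ℝ) : Prop :=
  Θ.PosDef ∧ Θ = Qbar Q R + (Phi A B (improvedGain Θ))ᵀ * Θ * Phi A B (improvedGain Θ)

/-- The square is completed at `T`, not at `D`, so the source measures only how far `K` is from the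
optimal gain. -/
theorem IsOptimal.sub_eq {T : Matrix (Fin n ⊕ Fin m) (Fin n ⊕ Fin m) ℝ}
    (hT : IsOptimal A B Q R T) {K : Matrix (Fin m) (Fin n) ℝ}
    {D : Matrix (Fin n ⊕ Fin m) (Fin n ⊕ Fin m) ℝ}
    (hD : D = Qbar Q R + (Phi A B K)ᵀ * D * Phi A B K) :
    D - T = gainExcess A B T K + (Phi A B K)ᵀ * (D - T) * Phi A B K := by
  have h1 := Phi_conj_eq (A := A) (B := B) hT.1 K
  have h2 : (Phi A B (improvedGain T))ᵀ * T * Phi A B (improvedGain T) = T - Qbar Q R :=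
    eq_sub_of_add_eq' hT.2.symm
  have h3 : (Phi A B K)ᵀ * D * Phi A B K = D - Qbar Q R := eq_sub_of_add_eq' hD.symm
  rw [Matrix.mul_sub, Matrix.sub_mul, h1, h2, h3]
  abel

theorem IsOptimal.unique (hQ : Q.PosDef) (hR : R.PosDef)
    {S T : Matrix (Fin n ⊕ Fin m) (Fin n ⊕ Fin m) ℝ} (hS : IsOptimal A B Q R S)
    (hT : IsOptimal A B Q R T) : S = T := by
  have key : ∀ {S T : Matrix (Fin n ⊕ Fin m) (Fin n ⊕ Fin m) ℝ}, IsOptimal A B Q R S →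
      IsOptimal A B Q R T → (S - T).PosSemidef := fun hS hT =>
    (powSqSummable_improvedGain hQ hR hS.1 hS.2).posSemidef (hT.sub_eq hS.2)
      (posSemidef_gainExcess hT.1 _)
  -- Both differences are positive semidefinite with opposite traces, so the norm vanishes.
  have h1 := PosSemidef.norm_le_trace (key hS hT)
  have h2 := PosSemidef.norm_le_trace (key hT hS)
  rw [norm_sub_rev, Matrix.trace_sub] at h2
  rw [Matrix.trace_sub] at h1
  exact sub_eq_zero.1 (norm_le_zero_iff.1 (by linarith))

/-- Stationarity of `S` and of `T` at their own gains gives `T_uu E = J (S - T) Φ`: the gain error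
is linear in `S - T`, hence the excess is quadratic. -/
theorem gainExcess_improvedGain {S T : Matrix (Fin n ⊕ Fin m) (Fin n ⊕ Fin m) ℝ} (hS : S.PosDef)
    (hT : T.PosDef) :
    gainExcess A B T (improvedGain S) = (Phi A B (improvedGain S))ᵀ *
      ((S - T) * ThetaBarU T * (S - T)) * Phi A B (improvedGain S) := by
  set E := (improvedGain S - improvedGain T) * Matrix.fromCols A B with hE
  set J := inputProj n m with hJ
  set Φ := Phi A B (improvedGain S) with hΦ
  have hu := PosDef.isUnit_det (PosDef.toBlocks₂₂ hT)
  have h1 : T.toBlocks₂₂ * E = J * (S - T) * Φ := by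
    have e1 := inputProj_mul_mul_improvedGain hS
    have e2 := inputProj_mul_mul_improvedGain hT
    rw [inputProj_mul_mul_feedbackRows] at e2
    rw [hΦ, Phi_eq_mul, ← Matrix.mul_assoc (J * (S - T)), Matrix.mul_sub, Matrix.sub_mul, e1,
      inputProj_mul_mul_feedbackRows, hE, ← Matrix.mul_assoc, Matrix.mul_sub]
    congr 1
    rw [← sub_eq_zero.1 e2]
    abel
  have h2 : gainExcess A B T (improvedGain S) =
      (T.toBlocks₂₂ * E)ᵀ * T.toBlocks₂₂⁻¹ * (T.toBlocks₂₂ * E) := by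
    rw [gainExcess, ← hE, Matrix.transpose_mul T.toBlocks₂₂, PosDef.transpose_eq (PosDef.toBlocks₂₂ hT),
      Matrix.mul_assoc Eᵀ _ (_⁻¹), Matrix.mul_nonsing_inv _ hu, Matrix.mul_one, Matrix.mul_assoc]
  rw [h2, h1, ThetaBarU_eq, ← hJ]
  simp only [Matrix.transpose_mul, Matrix.transpose_sub, PosDef.transpose_eq hS,
    PosDef.transpose_eq hT, Matrix.mul_assoc]

theorem hasSum_gamma1 {K : Matrix (Fin m) (Fin n) ℝ} (h : PowSqSummable (Phi A B K)) :
    HasSum (fun j : ℕ => ((Phi A B K ^ j)ᵀ * Phi A B K ^ j).trace) (gamma1 (Phi A B K)) := by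
  have hs : Summable fun j : ℕ => (Phi A B K ^ j)ᵀ * Phi A B K ^ j := by
    simpa using h.summable_conj 1
  exact hs.hasSum.map (Matrix.traceAddMonoidHom _ ℝ) (continuous_id.matrix_trace)

theorem tsum_sq_norm_le_gamma1 {K : Matrix (Fin m) (Fin n) ℝ} (h : PowSqSummable (Phi A B K)) :
    ∑' j : ℕ, ‖Phi A B K ^ j‖ ^ 2 ≤ gamma1 (Phi A B K) :=
  hasSum_le (fun _ => sq_norm_le_trace _) (Summable.hasSum h) (hasSum_gamma1 h)

theorem gamma1_pos (hm : 0 < m) {K : Matrix (Fin m) (Fin n) ℝ} (h : PowSqSummable (Phi A B K)) :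
    0 < gamma1 (Phi A B K) := by
  -- The term `j = 0` alone contributes the trace `n + m` of the identity.
  have h1 := (hasSum_gamma1 h).summable.sum_le_tsum (Finset.range 1)
    (fun j _ => (sq_nonneg _).trans (sq_norm_le_trace (Phi A B K ^ j)))
  rw [(hasSum_gamma1 h).tsum_eq] at h1
  simp at h1
  have : (0 : ℝ) < m := by exact_mod_cast hm
  have : (0 : ℝ) ≤ n := n.cast_nonneg
  linarith

theorem norm_ThetaBarU_pos (hm : 0 < m) {T : Matrix (Fin n ⊕ Fin m) (Fin n ⊕ Fin m) ℝ}
    (hT : T.PosDef) : 0 < ‖ThetaBarU T‖ := by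
  rw [norm_pos_iff]
  intro h
  have h1 := (PosDef.toBlocks₂₂ hT).inv.diag_pos (i := ⟨0, hm⟩)
  have h2 := congrFun (congrFun h (Sum.inr ⟨0, hm⟩)) (Sum.inr ⟨0, hm⟩)
  simp only [ThetaBarU, Matrix.fromBlocks_apply₂₂, Matrix.zero_apply] at h2
  linarith

/-- The error of the evaluation of the improved gain of `S` is quadratic in the error of `S`. -/
theorem IsOptimal.norm_sub_le {S T D : Matrix (Fin n ⊕ Fin m) (Fin n ⊕ Fin m) ℝ}
    (hT : IsOptimal A B Q R T) (hS : S.PosDef) (h : PowSqSummable (Phi A B (improvedGain S)))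
    (hD : D = Qbar Q R + (Phi A B (improvedGain S))ᵀ * D * Phi A B (improvedGain S)) :
    ‖D - T‖ ≤ gamma1 (Phi A B (improvedGain S)) * ‖ThetaBarU T‖ * ‖S - T‖ ^ 2 := by
  set Φ := Phi A B (improvedGain S) with hΦ
  set Z := (S - T) * ThetaBarU T * (S - T) with hZ
  have hZn : ‖Z‖ ≤ ‖ThetaBarU T‖ * ‖S - T‖ ^ 2 := by
    calc ‖Z‖ ≤ ‖S - T‖ * ‖ThetaBarU T‖ * ‖S - T‖ := by
          refine (norm_mul_le _ _).trans ?_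
          gcongr
          exact norm_mul_le _ _
      _ = _ := by ring
  have hsum := h.hasSum (hT.sub_eq hD)
  rw [gainExcess_improvedGain hS hT.1] at hsum
  have hs1 : Summable fun j : ℕ => ‖Φ ^ (j + 1)‖ ^ 2 :=
    (summable_nat_add_iff 1).2 h
  -- The source is itself conjugated by `Φ`, which shifts the powers by one; restoring the missing
  -- zeroth term only enlarges the sum.
  have hbound : ∀ j : ℕ, ‖(Φ ^ j)ᵀ * (Φᵀ * Z * Φ) * Φ ^ j‖ ≤ ‖Z‖ * ‖Φ ^ (j + 1)‖ ^ 2 := fun j => by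
    have : (Φ ^ j)ᵀ * (Φᵀ * Z * Φ) * Φ ^ j = (Φ ^ (j + 1))ᵀ * Z * Φ ^ (j + 1) := by
      rw [pow_succ', Matrix.transpose_mul]
      simp only [Matrix.mul_assoc]
    rw [this]
    exact norm_conj_le _ _
  have hshift : ∑' j : ℕ, ‖Φ ^ (j + 1)‖ ^ 2 ≤ ∑' j : ℕ, ‖Φ ^ j‖ ^ 2 := by
    rw [Summable.tsum_eq_zero_add h]
    exact le_add_of_nonneg_left (by positivity)
  calc ‖D - T‖ ≤ ∑' j : ℕ, ‖Z‖ * ‖Φ ^ (j + 1)‖ ^ 2 := by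
        rw [← hsum.tsum_eq]
        exact tsum_of_norm_bounded (hs1.mul_left _).hasSum hbound
    _ = ‖Z‖ * ∑' j : ℕ, ‖Φ ^ (j + 1)‖ ^ 2 := tsum_mul_left
    _ ≤ (‖ThetaBarU T‖ * ‖S - T‖ ^ 2) * gamma1 Φ := by
        gcongr
        exact hshift.trans (tsum_sq_norm_le_gamma1 h)
    _ = _ := by ring

end Gains

/-! ### The Riccati equation as the Bellman equation -/

section Riccati

variable {n m : ℕ} {A : Matrix (Fin n) (Fin n) ℝ} {B : Matrix (Fin n) (Fin m) ℝ}
  {Q : Matrix (Fin n) (Fin n) ℝ} {R : Matrix (Fin m) (Fin m) ℝ}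

/-- The state-action cost matrix of the value matrix `P`. -/
def actionCost (A : Matrix (Fin n) (Fin n) ℝ) (B : Matrix (Fin n) (Fin m) ℝ)
    (Q : Matrix (Fin n) (Fin n) ℝ) (R : Matrix (Fin m) (Fin m) ℝ) (P : Matrix (Fin n) (Fin n) ℝ) :
    Matrix (Fin n ⊕ Fin m) (Fin n ⊕ Fin m) ℝ :=
  Qbar Q R + (Matrix.fromCols A B)ᵀ * P * Matrix.fromCols A B

theorem actionCost_eq (P : Matrix (Fin n) (Fin n) ℝ) :
    actionCost A B Q R P =
      Matrix.fromBlocks (Q + Aᵀ * P * A) (Aᵀ * P * B) (Bᵀ * P * A) (R + Bᵀ * P * B) := by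
  rw [actionCost, Qbar, Matrix.transpose_fromCols, Matrix.fromRows_mul,
    Matrix.fromRows_mul_fromCols, Matrix.fromBlocks_add, zero_add, zero_add]

theorem posDef_actionCost (hQ : Q.PosDef) (hR : R.PosDef) {P : Matrix (Fin n) (Fin n) ℝ}
    (hP : P.PosSemidef) : (actionCost A B Q R P).PosDef :=
  (posDef_Qbar hQ hR).add_posSemidef (PosSemidef.conj hP _)

theorem improvedGain_actionCost (P : Matrix (Fin n) (Fin n) ℝ) :
    improvedGain (actionCost A B Q R P) = lqrGain A B R P := by
  simp [actionCost_eq, improvedGain, lqrGain]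

/-- The Riccati map is the Schur complement of the state-action cost. -/
theorem actionCost_conj_feedbackRows (hQ : Q.PosDef) (hR : R.PosDef)
    {P : Matrix (Fin n) (Fin n) ℝ} (hP : P.PosSemidef) :
    (feedbackRows (lqrGain A B R P))ᵀ * actionCost A B Q R P * feedbackRows (lqrGain A B R P) =
      Q + Aᵀ * P * A - Aᵀ * P * B * (R + Bᵀ * P * B)⁻¹ * (Bᵀ * P * A) := by
  have h := inputProj_mul_mul_improvedGain (posDef_actionCost (A := A) (B := B) hQ hR hP)
  rw [improvedGain_actionCost, inputProj_mul_mul_feedbackRows, actionCost_eq] at h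
  simp only [Matrix.toBlocks_fromBlocks₂₁, Matrix.toBlocks_fromBlocks₂₂] at h
  rw [actionCost_eq, Matrix.mul_assoc, feedbackRows, Matrix.fromBlocks_mul_fromRows,
    Matrix.transpose_fromRows, Matrix.fromCols_mul_fromRows, Matrix.mul_neg, Matrix.mul_neg,
    Matrix.mul_one, Matrix.mul_one, ← sub_eq_add_neg, ← sub_eq_add_neg, h, Matrix.mul_zero,
    add_zero, Matrix.transpose_one, Matrix.one_mul, lqrGain, Matrix.mul_assoc _ _⁻¹]

/-- With `F = [1; -K]` at the optimal gain, `T = Q̄ + [A B]ᵀ P [A B]` and `P = Fᵀ T F`; eliminating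
`P` gives the Bellman equation, eliminating `T` the Riccati equation. -/
theorem IsRiccatiSolution.isOptimal (hQ : Q.PosDef) (hR : R.PosDef)
    {P : Matrix (Fin n) (Fin n) ℝ} (hP : IsRiccatiSolution A B Q R P) :
    IsOptimal A B Q R (actionCost A B Q R P) := by
  refine ⟨posDef_actionCost hQ hR hP.1.posSemidef, ?_⟩
  have h := actionCost_conj_feedbackRows (A := A) (B := B) hQ hR hP.1.posSemidef
  rw [← hP.2] at h
  rw [improvedGain_actionCost, Phi_eq_mul]
  conv_lhs => rw [actionCost, ← h]
  simp only [Matrix.transpose_mul, Matrix.mul_assoc]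

theorem IsOptimal.isRiccatiSolution (hQ : Q.PosDef) (hR : R.PosDef)
    {T : Matrix (Fin n ⊕ Fin m) (Fin n ⊕ Fin m) ℝ} (hT : IsOptimal A B Q R T) :
    IsRiccatiSolution A B Q R
      ((feedbackRows (improvedGain T))ᵀ * T * feedbackRows (improvedGain T)) := by
  set P := (feedbackRows (improvedGain T))ᵀ * T * feedbackRows (improvedGain T) with hPdef
  have hPD : P.PosDef := by
    -- Definiteness survives because the identity block makes `[1; -K]` injective.
    have := hT.1.conjTranspose_mul_mul_same (B := feedbackRows (improvedGain T)) (fun v w hvw => by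
      simp only [feedbackRows, Matrix.fromRows_mulVec] at hvw
      funext i
      simpa using congrFun hvw (Sum.inl i))
    rwa [Matrix.conjTranspose_eq_transpose_of_trivial] at this
  have hTP : T = actionCost A B Q R P := by
    rw [actionCost, hPdef]
    conv_lhs => rw [hT.2]
    rw [Phi_eq_mul]
    simp only [Matrix.transpose_mul, Matrix.mul_assoc]
  refine ⟨hPD, ?_⟩
  rw [← actionCost_conj_feedbackRows hQ hR hPD.posSemidef, ← hTP]
  rw [← improvedGain_actionCost (Q := Q), ← hTP]

theorem continuousAt_improvedGain {T : Matrix (Fin n ⊕ Fin m) (Fin n ⊕ Fin m) ℝ}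
    (hT : T.PosDef) : ContinuousAt improvedGain T := by
  have h22 : Continuous fun Θ : Matrix (Fin n ⊕ Fin m) (Fin n ⊕ Fin m) ℝ => Θ.toBlocks₂₂ :=
    continuous_id.matrix_submatrix Sum.inr Sum.inr
  have h21 : Continuous fun Θ : Matrix (Fin n ⊕ Fin m) (Fin n ⊕ Fin m) ℝ => Θ.toBlocks₂₁ :=
    continuous_id.matrix_submatrix Sum.inr Sum.inl
  have hinv : ContinuousAt (fun S : Matrix (Fin m) (Fin m) ℝ => S⁻¹) T.toBlocks₂₂ := by
    refine continuousAt_matrix_inv _ ?_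
    obtain ⟨u, hu⟩ := PosDef.isUnit_det (PosDef.toBlocks₂₂ hT)
    rw [← hu]
    exact NormedRing.inverse_continuousAt u
  exact (continuous_fst.matrix_mul continuous_snd).continuousAt.comp₂
    (ContinuousAt.comp (f := fun Θ : Matrix (Fin n ⊕ Fin m) (Fin n ⊕ Fin m) ℝ => Θ.toBlocks₂₂)
      hinv h22.continuousAt) h21.continuousAt

theorem continuous_Phi : Continuous (Phi A B) := by
  unfold Phi
  exact Continuous.matrix_fromBlocks continuous_const continuous_const (by fun_prop) (by fun_prop)

end Riccati

/-! ### Convergence of policy iteration -/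

section PolicyIteration

variable {n m : ℕ} {A : Matrix (Fin n) (Fin n) ℝ} {B : Matrix (Fin n) (Fin m) ℝ}
  {Q : Matrix (Fin n) (Fin n) ℝ} {R : Matrix (Fin m) (Fin m) ℝ}

/-- Policy iteration: `Θ (i + 1)` is the cost of the gain `K i`, which `K (i + 1)` improves. -/
def IsPolicyIteration (A : Matrix (Fin n) (Fin n) ℝ) (B : Matrix (Fin n) (Fin m) ℝ)
    (Q : Matrix (Fin n) (Fin n) ℝ) (R : Matrix (Fin m) (Fin m) ℝ)
    (Θ : ℕ → Matrix (Fin n ⊕ Fin m) (Fin n ⊕ Fin m) ℝ) (K : ℕ → Matrix (Fin m) (Fin n) ℝ) : Prop :=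
  ∀ i, Θ (i + 1) = Qbar Q R + (Phi A B (K i))ᵀ * Θ (i + 1) * Phi A B (K i) ∧
    K (i + 1) = improvedGain (Θ (i + 1))

variable {Θ : ℕ → Matrix (Fin n ⊕ Fin m) (Fin n ⊕ Fin m) ℝ} {K : ℕ → Matrix (Fin m) (Fin n) ℝ}

namespace IsPolicyIteration

theorem powSqSummable (h : IsPolicyIteration A B Q R Θ K) (hQ : Q.PosDef) (hR : R.PosDef)
    (h0 : PowSqSummable (Phi A B (K 0))) (i : ℕ) : PowSqSummable (Phi A B (K i)) := by
  induction i with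
  | zero => exact h0
  | succ i ih =>
    rw [(h i).2]
    exact powSqSummable_improvedGain hQ hR (ih.posDef (h i).1 (posDef_Qbar hQ hR)) (h i).1

theorem posDef (h : IsPolicyIteration A B Q R Θ K) (hQ : Q.PosDef) (hR : R.PosDef)
    (h0 : PowSqSummable (Phi A B (K 0))) (i : ℕ) : (Θ (i + 1)).PosDef :=
  (h.powSqSummable hQ hR h0 i).posDef (h i).1 (posDef_Qbar hQ hR)

/-- Both costs satisfy Lyapunov equations for the same `Φ`, that of `K (i + 1)`; the older one has
the excess as additional source. -/
theorem posSemidef_sub (h : IsPolicyIteration A B Q R Θ K) (hQ : Q.PosDef) (hR : R.PosDef)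
    (h0 : PowSqSummable (Phi A B (K 0))) (i : ℕ) : (Θ (i + 1) - Θ (i + 2)).PosSemidef := by
  have hP := h.posDef hQ hR h0 i
  have h1 := eq_add_gainExcess_add hP (h i).1
  rw [← (h i).2] at h1
  have h2 : Θ (i + 2) =
      Qbar Q R + (Phi A B (K (i + 1)))ᵀ * Θ (i + 2) * Phi A B (K (i + 1)) := (h (i + 1)).1
  refine (h.powSqSummable hQ hR h0 (i + 1)).posSemidef (X := gainExcess A B (Θ (i + 1)) (K i)) ?_
    (posSemidef_gainExcess hP _)
  rw [Matrix.mul_sub, Matrix.sub_mul, eq_sub_of_add_eq' h1.symm, eq_sub_of_add_eq' h2.symm]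
  abel

theorem exists_tendsto (h : IsPolicyIteration A B Q R Θ K) (hQ : Q.PosDef) (hR : R.PosDef)
    (h0 : PowSqSummable (Phi A B (K 0))) : ∃ T, IsOptimal A B Q R T ∧ Tendsto Θ atTop (𝓝 T) := by
  obtain ⟨T, hT⟩ := exists_tendsto_of_antitone (S := fun i => Θ (i + 1))
    (fun i => (h.posDef hQ hR h0 i).posSemidef) (h.posSemidef_sub hQ hR h0)
  have hTpos : T.PosDef := by
    -- All iterates dominate `Q̄`, so the limit is definite and its improved gain depends
    -- continuously on it.
    have h1 : (T - Qbar Q R).PosSemidef :=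
      posSemidef_closed.mem_of_tendsto (hT.sub_const _) (Eventually.of_forall fun i => by
        have := PosSemidef.conj (h.posDef hQ hR h0 i).posSemidef (Phi A B (K i))
        rwa [eq_sub_of_add_eq' (h i).1.symm] at this)
    simpa using (posDef_Qbar hQ hR).add_posSemidef h1
  have hK : Tendsto (fun i => K (i + 1)) atTop (𝓝 (improvedGain T)) := by
    simp_rw [fun i => (h i).2]
    exact (continuousAt_improvedGain hTpos).tendsto.comp hT
  have hΦ : Tendsto (fun i => Phi A B (K (i + 1))) atTop (𝓝 (Phi A B (improvedGain T))) :=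
    (continuous_Phi.tendsto _).comp hK
  have hT2 : Tendsto (fun i => Θ (i + 2)) atTop (𝓝 T) := hT.comp (tendsto_add_atTop_nat 1)
  refine ⟨T, ⟨hTpos, tendsto_nhds_unique hT2 ?_⟩, (tendsto_add_atTop_iff_nat 1).1 hT⟩
  have hcont : Continuous fun q : Matrix (Fin n ⊕ Fin m) (Fin n ⊕ Fin m) ℝ ×
      Matrix (Fin n ⊕ Fin m) (Fin n ⊕ Fin m) ℝ => Qbar Q R + q.1ᵀ * q.2 * q.1 := by fun_prop
  exact ((hcont.tendsto (Phi A B (improvedGain T), T)).comp (hΦ.prodMk_nhds hT2)).congr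
    fun i => (h (i + 1)).1.symm

/-- The constants `γ₁` are bounded along a policy iteration. -/
theorem exists_gamma1_le (h : IsPolicyIteration A B Q R Θ K) (hQ : Q.PosDef) (hR : R.PosDef)
    (h0 : PowSqSummable (Phi A B (K 0))) : ∃ c > 0, ∀ i, gamma1 (Phi A B (K i)) ≤ c := by
  obtain ⟨c, hc, hb⟩ := exists_tsum_sq_norm_le (posDef_Qbar hQ hR)
  let tr := LinearMap.toContinuousLinearMap
    (Matrix.traceLinearMap (Fin n ⊕ Fin m) ℝ ℝ)
  have htr : ∀ M : Matrix (Fin n ⊕ Fin m) (Fin n ⊕ Fin m) ℝ, M.trace ≤ ‖tr‖ * ‖M‖ := fun M =>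
    (le_abs_self _).trans (tr.le_opNorm M)
  have hanti : ∀ i, (Θ (i + 1)).trace ≤ (Θ 1).trace := fun i => by
    induction i with
    | zero => exact le_rfl
    | succ i ih =>
      have := (h.posSemidef_sub hQ hR h0 i).trace_nonneg
      rw [Matrix.trace_sub] at this
      exact (sub_nonneg.1 this).trans ih
  have htr1 : 0 ≤ (Θ 1).trace := (h.posDef hQ hR h0 0).posSemidef.trace_nonneg
  -- `‖tr‖` converts traces into norms, and `c` depends only on `Q̄`; the summand 1 ensures
  -- positivity.
  refine ⟨‖tr‖ * (c * (Θ 1).trace) + 1, by positivity, fun i => ?_⟩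
  obtain ⟨hs, hle⟩ := hb (Phi A B (K i)) (Θ (i + 1)) 0 (h.posDef hQ hR h0 i).posSemidef
    Matrix.PosSemidef.zero (by simpa using (h i).1)
  have h1 : gamma1 (Phi A B (K i)) ≤ ‖tr‖ * ∑' j : ℕ, ‖Phi A B (K i) ^ j‖ ^ 2 :=
    hasSum_le (fun j => by rw [← sq_norm_eq]; exact htr _) (hasSum_gamma1 hs)
      ((Summable.hasSum hs).mul_left _)
  calc gamma1 (Phi A B (K i)) ≤ ‖tr‖ * (c * (Θ 1).trace) := by
        refine h1.trans ?_
        gcongr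
        refine hle.trans ?_
        gcongr
        exact hanti i
    _ ≤ _ := by linarith

end IsPolicyIteration

theorem exists_isPolicyIteration (hQ : Q.PosDef) (hR : R.PosDef) (K₀ : Matrix (Fin m) (Fin n) ℝ)
    (h0 : PowSqSummable (Phi A B K₀)) : ∃ Θ K, K 0 = K₀ ∧ IsPolicyIteration A B Q R Θ K := by
  let cost : Matrix (Fin m) (Fin n) ℝ → Matrix (Fin n ⊕ Fin m) (Fin n ⊕ Fin m) ℝ := fun L =>
    ∑' j : ℕ, (Phi A B L ^ j)ᵀ * Qbar Q R * Phi A B L ^ j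
  let K : ℕ → Matrix (Fin m) (Fin n) ℝ := fun i => Nat.rec K₀ (fun _ L => improvedGain (cost L)) i
  have hstable : ∀ i, PowSqSummable (Phi A B (K i)) := fun i => by
    induction i with
    | zero => exact h0
    | succ i ih =>
      have h1 := ih.solution (Qbar Q R)
      exact powSqSummable_improvedGain hQ hR (ih.posDef h1 (posDef_Qbar hQ hR)) h1
  -- The truncated `i - 1` gives `Θ 0` an arbitrary value, which is never used.
  exact ⟨fun i => cost (K (i - 1)), K, rfl, fun i => ⟨(hstable i).solution (Qbar Q R), rfl⟩⟩

end PolicyIteration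

end QLearning

/-! ### Quadratic convergence of off-policy Q-learning -/

theorem theorem6 {n m : ℕ} (hm : 0 < m)
    (A : Matrix (Fin n) (Fin n) ℝ) (B : Matrix (Fin n) (Fin m) ℝ) (hAB : Controllable A B)
    (Q : Matrix (Fin n) (Fin n) ℝ) (R : Matrix (Fin m) (Fin m) ℝ) (hQ : Q.PosDef) (hR : R.PosDef)
    (x : ℕ → Fin n → ℝ) (u : ℕ → Fin m → ℝ)
    (hx : ∀ k < numUnknowns n m, x (k + 1) = A *ᵥ x k + B *ᵥ u k)
    (hu : PersistentlyExciting u (numUnknowns n m + 1) (n + 1))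
    (hz : LinearIndependent ℝ (fun k : Fin (numUnknowns n m) =>
      Matrix.vecMulVec (stack (x k) (u k)) (stack (x k) (u k))))
    (K₀ : Matrix (Fin m) (Fin n) ℝ) (hK₀ : IsStabilizing A B K₀) :
    (∃ Θ K, IsRun Q R x u K₀ Θ K) ∧ (∃ P, IsRiccatiSolution A B Q R P) ∧
    ∀ (Θ : ℕ → Matrix (Fin n ⊕ Fin m) (Fin n ⊕ Fin m) ℝ) (K : ℕ → Matrix (Fin m) (Fin n) ℝ)
      (P : Matrix (Fin n) (Fin n) ℝ) (Θstar : Matrix (Fin n ⊕ Fin m) (Fin n ⊕ Fin m) ℝ),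
      IsRun Q R x u K₀ Θ K →
      IsRiccatiSolution A B Q R P →
      Θstar = Qbar Q R + (Phi A B (lqrGain A B R P))ᵀ * Θstar * Phi A B (lqrGain A B R P) →
      Tendsto Θ atTop (𝓝 Θstar) ∧
      (∀ i ≥ 1,
        Summable (fun j : ℕ => (Phi A B (K i) ^ j)ᵀ * Phi A B (K i) ^ j) ∧
        0 < gamma1 (Phi A B (K i)) * ‖ThetaBarU Θstar‖ ∧
        ‖Θ (i + 1) - Θstar‖ ≤
          gamma1 (Phi A B (K i)) * ‖ThetaBarU Θstar‖ * ‖Θ i - Θstar‖ ^ 2) ∧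
      ∃ γ > 0, ∀ i ≥ 1, ‖Θ (i + 1) - Θstar‖ ≤ γ * ‖Θ i - Θstar‖ ^ 2 := by
  have hrun : ∀ Θ K, IsRun Q R x u K₀ Θ K ↔
      K 0 = K₀ ∧ (∀ i, (Θ (i + 1)).IsSymm) ∧ IsPolicyIteration A B Q R Θ K := fun Θ K => by
    simp only [IsRun, IsPolicyIteration, solvesDataEquations_iff hx hz (PosDef.transpose_eq hQ)
      (PosDef.transpose_eq hR), forall_and]
    tauto
  have h0 := IsStabilizing.powSqSummable hK₀
  obtain ⟨Θ₁, K₁, hK₁, h₁⟩ := exists_isPolicyIteration hQ hR K₀ h0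
  refine ⟨⟨Θ₁, K₁, (hrun _ _).2 ⟨hK₁, fun i =>
    PosDef.transpose_eq (h₁.posDef hQ hR (hK₁ ▸ h0) i), h₁⟩⟩, ?_, ?_⟩
  · obtain ⟨T, hT, -⟩ := h₁.exists_tendsto hQ hR (hK₁ ▸ h0)
    exact ⟨_, hT.isRiccatiSolution hQ hR⟩
  intro Θ K P T hr hP hT
  obtain ⟨rfl, -, h⟩ := (hrun Θ K).1 hr
  have hPo := hP.isOptimal hQ hR
  -- No symmetry or positivity of `T` is needed: the optimal gain is stable, so its Lyapunov
  -- equation has one solution.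
  obtain rfl : T = actionCost A B Q R P := by
    have h1 := powSqSummable_improvedGain hQ hR hPo.1 hPo.2
    have h2 := hPo.2
    rw [improvedGain_actionCost] at h1
    rw [improvedGain_actionCost] at h2
    exact h1.unique hT h2
  have hstable := h.powSqSummable hQ hR h0
  have hTheta := norm_ThetaBarU_pos hm hPo.1
  have hquad : ∀ i ≥ 1, ‖Θ (i + 1) - actionCost A B Q R P‖ ≤ gamma1 (Phi A B (K i)) *
      ‖ThetaBarU (actionCost A B Q R P)‖ * ‖Θ i - actionCost A B Q R P‖ ^ 2 := fun i hi => by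
    -- For `i ≥ 1` the gain `K i` is the improved gain of `Θ i`, as the estimate requires; `K 0` is
    -- not of this form in general.
    obtain ⟨i, rfl⟩ := Nat.exists_eq_add_of_le' hi
    have hs := hstable (i + 1)
    have he := (h (i + 1)).1
    rw [(h i).2] at hs he ⊢
    exact hPo.norm_sub_le (h.posDef hQ hR h0 i) hs he
  refine ⟨?_, fun i hi => ⟨by simpa using (hstable i).summable_conj 1,
    mul_pos (gamma1_pos hm (hstable i)) hTheta, hquad i hi⟩, ?_⟩
  · obtain ⟨S, hS, hlim⟩ := h.exists_tendsto hQ hR h0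
    rwa [hS.unique hQ hR hPo] at hlim
  · obtain ⟨c, hc, hb⟩ := h.exists_gamma1_le hQ hR h0
    refine ⟨c * ‖ThetaBarU (actionCost A B Q R P)‖, by positivity, fun i hi =>
      (hquad i hi).trans ?_⟩
    gcongr
    exact hb i
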